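/- Let $V$ be a vector space of dimension $n$ over the finite field $\mathbb F_q$ and let $1\le k\le n-1$. Let $\Omega\subseteq \mathrm{PG}(\bigwedge^k V)$ be the image of the Grassmann embedding, i.e. the set of all points $[v_1\wedge v_2\wedge\dots\wedge v_k]$ where $\langle v_1,\dots,v_k\rangle$ ranges over the $k$-dimensional subspaces of $V$. Let $\mathcal C_{n,k}\le\mathbb F_q^N$ be a Grassmann code, that is, a linear code of length $N=|\Omega|$ generated by the rows of a matrix whose columns are the coordinates, with respect to a fixed basis of $\bigwedge^kV$, of vectors representing the points of $\Omega$, each point exactly once (such a code is unique up to monomial equivalence). Then $\mathcal C_{n,k}$ is a minimal code: whenever $c,c'\in\mathcal C_{n,k}$ satisfy $\mathrm{supp}(c')\subseteq\mathrm{supp}(c)$, there is $\lambda\in\mathbb F_q$ with $c'=\lambda c$. Moreover its length $N$, dimension $K$ and minimum Hamming distance $d$ are \[ N=\begin{bmatrix}n\\k\end{bmatrix}_q=\frac{(q^n-1)(q^n-q)\cdots(q^n-q^{k-1})}{(q^k-1)(q^k-q)\cdots(q^k-q^{k-1})},\qquad K=\binom{n}{k},\qquad d=q^{k(n-k)}.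 \] -/

import Mathlib

open scoped LinearAlgebra.Projectivization

namespace MinimalCodes

section Codes

variable {F : Type*} [Field F] {N : ℕ}

/-- A codeword `c` of a linear code `C ≤ F^N` is minimal if every codeword whose support is contained
in the support of `c` is a scalar multiple of `c`. -/
def IsMinimalCodeword (C : Submodule F (Fin N → F)) (c : Fin N → F) : Prop :=
  c ∈ C ∧ ∀ c' ∈ C, Function.support c' ⊆ Function.support c → ∃ a : F, c' = a • c

/-- A linear code is minimal if all its codewords are minimal. -/
def IsMinimalCode (C : Submodule F (Fin N → F)) : Prop :=
  ∀ c ∈ C, IsMinimalCodeword C c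

/-- `d` is the minimum (Hamming) distance between distinct codewords of `C`. -/
def IsMinimumDistance [DecidableEq F] (C : Submodule F (Fin N → F)) (d : ℕ) : Prop :=
  IsLeast {m : ℕ | ∃ x ∈ C, ∃ y ∈ C, x ≠ y ∧ hammingDist x y = m} d

end Codes

section ProjectiveSystems

variable {F W : Type*} [Field F] [AddCommGroup W] [Module F W]

/-- `C ≤ F^N` is a code `𝒞(Ω)` arising from the set of points `Ω` of `PG(W)`: for some reference
system (a basis `b` of `W`), some ordering of the points of `Ω` and some choice of vectors `v j`
representing these points (each point of `Ω` exactly once), `C` is generated by the rows of the matrix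
`b.toMatrix v`, whose `j`-th column holds the coordinates of `v j`. For given `Ω` these codes are all
monomially equivalent. -/
def IsCodeOf (Ω : Set (ℙ F W)) {N : ℕ} (C : Submodule F (Fin N → F)) : Prop :=
  ∃ (m : ℕ) (b : Module.Basis (Fin m) F W) (v : Fin N → W) (hv : ∀ j, v j ≠ 0),
    Set.BijOn (fun j => Projectivization.mk F (v j) (hv j)) Set.univ Ω ∧
      C = Submodule.span F (Set.range (b.toMatrix v).row)

/-- Every finite set of points of a finite-dimensional projective space gives rise to a code. -/
theorem exists_isCodeOf [Module.Finite F W] (Ω : Set (ℙ F W)) (hΩ : Ω.Finite) :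
    ∃ (N : ℕ) (C : Submodule F (Fin N → F)), IsCodeOf Ω C := by
  have := hΩ.to_subtype
  let e := (Finite.equivFin Ω).symm
  refine ⟨Nat.card Ω, _, _, Module.finBasis F W, fun j => (e j : ℙ F W).rep,
    fun j => Projectivization.rep_nonzero _, ?_, rfl⟩
  simp only [Projectivization.mk_rep]
  exact ⟨fun j _ => (e j).2, fun i _ j _ h => e.injective (Subtype.ext h),
    fun P hP => ⟨e.symm ⟨P, hP⟩, trivial, congrArg Subtype.val (e.apply_symm_apply ⟨P, hP⟩)⟩⟩

end ProjectiveSystems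

section Grassmann

variable (F V : Type*) [Field F] [AddCommGroup V] [Module F V]

/-- The points of the `k`-Grassmann geometry of `PG(V)`: the `k`-dimensional subspaces of `V`. -/
abbrev GrassmannPoint (k : ℕ) : Type _ := {X : Submodule F V // Module.finrank F X = k}

variable {F V}

/-- The wedge of linearly independent vectors is nonzero. -/
theorem wedge_ne_zero {k : ℕ} {v : Fin k → V} (hv : LinearIndependent F v) :
    exteriorPower.ιMulti F k v ≠ 0 := by
  obtain ⟨g, hg⟩ := (Fintype.linearCombination F v).exists_leftInverse_of_injective
    (LinearMap.ker_eq_bot.2 hv.fintypeLinearCombination_injective)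
  have hgv : ∀ i, g (v i) = Pi.single i 1 := fun i => by
    have := LinearMap.congr_fun hg (Pi.single i 1)
    simpa [Fintype.linearCombination_apply_single] using this
  intro h
  have h1 := exteriorPower.alternatingMapLinearEquiv_apply_ιMulti
    ((Matrix.detRowAlternating (n := Fin k) (R := F)).compLinearMap g) v
  rw [h, map_zero, AlternatingMap.compLinearMap_apply] at h1
  have h2 : (fun i => g (v i)) = (1 : Matrix (Fin k) (Fin k) F) := by
    ext i j
    rw [hgv, Matrix.one_apply, Pi.single_apply]
    simp [eq_comm]
  have h3 : Matrix.detRowAlternating (fun i => g (v i)) = (1 : F) := by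
    rw [h2]
    exact Matrix.det_one
  exact zero_ne_one (h1.trans h3)

variable [Module.Finite F V]

/-- A basis of a `k`-dimensional subspace, as a family of vectors of `V`. -/
noncomputable def frame {k : ℕ} (X : GrassmannPoint F V k) : Fin k → V :=
  fun i => (Module.finBasisOfFinrankEq F X.1 X.2 i : V)

theorem frame_linearIndependent {k : ℕ} (X : GrassmannPoint F V k) :
    LinearIndependent F (frame X) :=
  (Module.finBasisOfFinrankEq F X.1 X.2).linearIndependent.map' X.1.subtype X.1.ker_subtype

/-- The Grassmann embedding, which sends `⟨v₁, …, v_k⟩` to the point `[v₁ ∧ ⋯ ∧ v_k]` of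
`PG(⋀^k V)`; by `grassmannEmbedding_eq` the choice of the basis is irrelevant. -/
noncomputable def grassmannEmbedding (k : ℕ) (X : GrassmannPoint F V k) : ℙ F (⋀[F]^k V) :=
  Projectivization.mk F (exteriorPower.ιMulti F k (frame X))
    (wedge_ne_zero (frame_linearIndependent X))

theorem grassmannEmbedding_eq {k : ℕ} (X : GrassmannPoint F V k) (v : Fin k → V)
    (hv : LinearIndependent F v) (hX : Submodule.span F (Set.range v) = X.1) :
    grassmannEmbedding k X =
      Projectivization.mk F (exteriorPower.ιMulti F k v) (wedge_ne_zero hv) := by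
  symm
  rw [grassmannEmbedding, Projectivization.mk_eq_mk_iff']
  let b := Module.finBasisOfFinrankEq F X.1 X.2
  let w : Fin k → X.1 := fun i => ⟨v i, hX ▸ Submodule.subset_span ⟨i, rfl⟩⟩
  have key : (exteriorPower.ιMulti F k (M := V)).compLinearMap X.1.subtype =
      (LinearMap.toSpanSingleton F _ (exteriorPower.ιMulti F k (frame X))).compAlternatingMap
        b.det := by
    refine Module.Basis.ext_alternating b fun i hi => ?_
    let σ : Equiv.Perm (Fin k) := Equiv.ofBijective i (Finite.injective_iff_bijective.1 hi)
    have h1 : ((exteriorPower.ιMulti F k (M := V)).compLinearMap X.1.subtype) (b ∘ σ) =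
      (LinearMap.toSpanSingleton F _ (exteriorPower.ιMulti F k (frame X))).compAlternatingMap
        b.det (b ∘ σ) := by
      rw [AlternatingMap.map_perm, AlternatingMap.map_perm]
      congr 1
      simp [b.det_self]
      rfl
    exact h1
  have := congrArg (fun f => f w) key
  exact ⟨b.det w, this.symm⟩

variable (V) in
/-- `C` is a Grassmann code `𝒞_{n,k}` (where `n = dim V`): a code arising from the set of all points
`[v₁ ∧ ⋯ ∧ v_k]` of `PG(⋀^k V)`, the image of the Grassmann embedding. -/
def IsGrassmannCode (k : ℕ) {N : ℕ} (C : Submodule F (Fin N → F)) : Prop :=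
  IsCodeOf (Set.range (grassmannEmbedding (F := F) (V := V) k)) C

variable (F V) in
/-- Over a finite field, Grassmann codes exist. -/
theorem exists_isGrassmannCode [Finite F] (k : ℕ) :
    ∃ (N : ℕ) (C : Submodule F (Fin N → F)), IsGrassmannCode V k C := by
  have : Finite V := Module.finite_of_finite F
  have : Finite (Submodule F V) := Finite.of_injective _ SetLike.coe_injective
  exact exists_isCodeOf _ (Set.finite_range _)

end Grassmann

end MinimalCodes

/-!
Codewords of the code of `Ω ⊆ PG(W)` are evaluations of linear functionals on `W`, zero at the points
of `Ω` in the kernel. For the Grassmann embedding these functionals are the alternating `k`-forms `φ`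
on `V`, and `φ` is zero at the point of `X` iff it restricts to zero on `X`.

The code is minimal because a multilinear form vanishing wherever `φ` does is a multiple of `φ`: by
induction its contractions are multiples of those of `φ`, and pointwise proportional linear maps are
proportional. For the weights, `φ` takes nonzero values exactly on the bases of the `k`-subspaces on
which it is nonzero, so the weight times `|GL_k(q)|` is the number of `k`-tuples with `φ v ≠ 0`. An
induction on `k` bounds this number below by
`(q^n - q^(n-1)) ⋯ (q^n - q^(n-k)) = q^(k(n-k)) |GL_k(q)|`, with equality for the determinant of `k`
coordinates.
-/

namespace MinimalCodes

section ProjectiveSystems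

variable {F W : Type*} [Field F] [AddCommGroup W] [Module F W] {Ω : Set (ℙ F W)} {N : ℕ}
  {C : Submodule F (Fin N → F)}

theorem IsCodeOf.exists_eq_range (hC : IsCodeOf Ω C) :
    ∃ (e : Fin N ≃ Ω) (c : Module.Dual F W →ₗ[F] Fin N → F), C = LinearMap.range c ∧
      ∀ f j, c f j = 0 ↔ (e j).1.submodule ≤ LinearMap.ker f := by
  obtain ⟨m, b, v, hv, hbij, rfl⟩ := hC
  refine ⟨(Equiv.Set.univ _).symm.trans (hbij.equiv _),
    LinearMap.pi fun j => Module.Dual.eval F W (v j), ?_, fun f j => ?_⟩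
  · rw [LinearMap.range_eq_map, ← b.dualBasis.span_eq, Submodule.map_span, ← Set.range_comp]
    congr 2
    ext i j
    simp [Module.Basis.toMatrix_apply]
  · change f (v j) = 0 ↔ (Projectivization.mk F (v j) (hv j)).submodule ≤ LinearMap.ker f
    rw [Projectivization.submodule_mk, Submodule.span_singleton_le_iff_mem, LinearMap.mem_ker]

theorem IsCodeOf.length_eq_ncard (hC : IsCodeOf Ω C) : N = Ω.ncard := by
  obtain ⟨e, -⟩ := hC.exists_eq_range
  simpa using Nat.card_congr e

/-- `Ω` is a cutting set: every hyperplane of `PG(W)` is spanned by the points of `Ω` in it. This is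
encoded dually, by saying that the equation `f = 0` of a hyperplane is determined up to a factor by
these points; the case `f = 0` says in addition that `Ω` spans `PG(W)`. -/
def IsCutting (Ω : Set (ℙ F W)) : Prop :=
  ∀ f g : Module.Dual F W,
    (∀ P ∈ Ω, P.submodule ≤ LinearMap.ker f → P.submodule ≤ LinearMap.ker g) → ∃ a : F, g = a • f

theorem IsCutting.eq_zero (hΩ : IsCutting Ω) {f : Module.Dual F W}
    (hf : ∀ P ∈ Ω, P.submodule ≤ LinearMap.ker f) : f = 0 := by
  obtain ⟨a, rfl⟩ := hΩ 0 f fun P hP _ => hf P hP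
  exact smul_zero a

theorem IsCodeOf.isMinimalCode (hC : IsCodeOf Ω C) (hΩ : IsCutting Ω) : IsMinimalCode C := by
  obtain ⟨e, c, rfl, hc⟩ := hC.exists_eq_range
  rintro _ ⟨f, rfl⟩
  refine ⟨⟨f, rfl⟩, ?_⟩
  rintro _ ⟨g, rfl⟩ hsupp
  obtain ⟨a, rfl⟩ := hΩ f g fun P hP hPf => by
    obtain ⟨j, hj⟩ := e.surjective ⟨P, hP⟩
    have hfg : c f j = 0 → c g j = 0 := not_imp_not.1 (@hsupp j)
    rw [hc, hc, hj] at hfg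
    exact hfg hPf
  exact ⟨a, map_smul c a f⟩

theorem injective_of_apply_eq_zero_iff (e : Fin N ≃ Ω) {c : Module.Dual F W →ₗ[F] Fin N → F}
    (hc : ∀ f j, c f j = 0 ↔ (e j).1.submodule ≤ LinearMap.ker f)
    (hΩ : ∀ f : Module.Dual F W, (∀ P ∈ Ω, P.submodule ≤ LinearMap.ker f) → f = 0) :
    Function.Injective c := by
  refine (injective_iff_map_eq_zero c).2 fun f hf => hΩ f fun P hP => ?_
  simpa using (hc f (e.symm ⟨P, hP⟩)).1 (congrFun hf _)

theorem IsCodeOf.finrank_eq [Module.Finite F W] (hC : IsCodeOf Ω C)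
    (hΩ : ∀ f : Module.Dual F W, (∀ P ∈ Ω, P.submodule ≤ LinearMap.ker f) → f = 0) :
    Module.finrank F C = Module.finrank F W := by
  obtain ⟨e, c, rfl, hc⟩ := hC.exists_eq_range
  rw [LinearMap.finrank_range_of_inj (injective_of_apply_eq_zero_iff e hc hΩ),
    Subspace.dual_finrank_eq]

theorem hammingNorm_eq_ncard [DecidableEq F] (e : Fin N ≃ Ω) {x : Fin N → F} {p : ℙ F W → Prop}
    (hx : ∀ j, x j = 0 ↔ p (e j)) : hammingNorm x = {P ∈ Ω | ¬ p P}.ncard := by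
  rw [hammingNorm, ← Set.ncard_coe_finset,
    ← Set.ncard_image_of_injective _ (Subtype.val_injective.comp e.injective)]
  congr 1
  ext P
  simp only [Finset.coe_filter_univ, ne_eq, hx, Set.mem_image, Set.mem_ofPred_eq,
    Function.comp_apply]
  exact ⟨by rintro ⟨j, hj, rfl⟩; exact ⟨(e j).2, hj⟩,
    fun ⟨hP, hpP⟩ => ⟨e.symm ⟨P, hP⟩, by simpa using hpP, by simp⟩⟩

theorem IsCodeOf.isMinimumDistance [DecidableEq F] (hC : IsCodeOf Ω C)
    (hΩ : ∀ f : Module.Dual F W, (∀ P ∈ Ω, P.submodule ≤ LinearMap.ker f) → f = 0) {d : ℕ}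
    (hd : IsLeast
      {m | ∃ f : Module.Dual F W, f ≠ 0 ∧ {P ∈ Ω | ¬ P.submodule ≤ LinearMap.ker f}.ncard = m} d) :
    IsMinimumDistance C d := by
  obtain ⟨e, c, rfl, hc⟩ := hC.exists_eq_range
  have hinj := injective_of_apply_eq_zero_iff e hc hΩ
  have hweight (f) : hammingNorm (c f) = {P ∈ Ω | ¬ P.submodule ≤ LinearMap.ker f}.ncard :=
    hammingNorm_eq_ncard e (hc f)
  obtain ⟨⟨f, hf, hfd⟩, hmin⟩ := hd
  refine ⟨⟨c f, ⟨f, rfl⟩, 0, zero_mem _, (map_ne_zero_iff c hinj).2 hf, ?_⟩, ?_⟩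
  · rw [hammingDist_zero_right, hweight, hfd]
  · rintro _ ⟨_, ⟨g, rfl⟩, _, ⟨h, rfl⟩, hgh, rfl⟩
    rw [hammingDist_eq_hammingNorm, ← map_neg, ← map_add, hweight]
    exact hmin ⟨-g + h, fun h0 => hgh (by rw [neg_add_eq_zero.1 h0]), rfl⟩

end ProjectiveSystems

section MultilinearForms

variable {F : Type*} [Field F]

theorem exists_eq_smul_of_forall_apply {V W : Type*} [AddCommGroup V] [Module F V]
    [AddCommGroup W] [Module F W] {A B : V →ₗ[F] W} (h : ∀ v, ∃ a : F, B v = a • A v) :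
    ∃ a : F, B = a • A := by
  by_cases hA : A = 0
  · refine ⟨0, LinearMap.ext fun v => ?_⟩
    obtain ⟨a, ha⟩ := h v
    simpa [hA] using ha
  obtain ⟨e, he⟩ : ∃ e, A e ≠ 0 := by simpa [LinearMap.ext_iff] using hA
  obtain ⟨a, ha⟩ := h e
  refine ⟨a, LinearMap.ext fun v => ?_⟩
  by_cases hspan : ∃ r : F, r • A e = A v
  · obtain ⟨r, hr⟩ := hspan
    obtain ⟨b, hb⟩ := h (v - r • e)
    have hB : B v = r • B e := by
      rwa [map_sub, map_sub, map_smul, map_smul, hr, sub_self, smul_zero, sub_eq_zero] at hb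
    rw [hB, ha, LinearMap.smul_apply, ← hr, smul_comm]
  · obtain ⟨b, hb⟩ := h v
    obtain ⟨c, hc⟩ := h (v + e)
    have hcomb : (c - b) • A v = (a - c) • A e := by
      rw [map_add, map_add, hb, ha, smul_add] at hc
      rw [sub_smul, sub_smul, sub_eq_sub_iff_add_eq_add, ← hc, add_comm]
    have hcb : c = b := by
      by_contra hne
      exact hspan ⟨(c - b)⁻¹ * (a - c), by
        rw [mul_smul, ← hcomb, inv_smul_smul₀ (sub_ne_zero.2 hne)]⟩
    have hac : a = c := by
      rw [hcb, sub_self, zero_smul, eq_comm, smul_eq_zero_iff_left he, sub_eq_zero] at hcomb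
      rw [hcomb, hcb]
    rw [hb, LinearMap.smul_apply, hac, hcb]

theorem exists_eq_smul_of_eq_zero_imp {k : ℕ} {M : Fin k → Type*} [∀ i, AddCommGroup (M i)]
    [∀ i, Module F (M i)] {φ ψ : MultilinearMap F M F} (h : ∀ v, φ v = 0 → ψ v = 0) :
    ∃ a : F, ψ = a • φ := by
  induction k with
  | zero =>
    by_cases h0 : φ 0 = 0
    · refine ⟨0, MultilinearMap.ext fun v => ?_⟩
      rw [Subsingleton.elim v 0, h 0 h0, zero_smul, zero_apply]
    · refine ⟨ψ 0 / φ 0, MultilinearMap.ext fun v => ?_⟩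
      rw [Subsingleton.elim v 0, smul_apply, smul_eq_mul, div_mul_cancel₀ _ h0]
  | succ k ih =>
    obtain ⟨a, ha⟩ := exists_eq_smul_of_forall_apply (A := φ.curryLeft) (B := ψ.curryLeft)
      fun x => ih fun w hw => h _ hw
    refine ⟨a, MultilinearMap.ext fun v => ?_⟩
    simpa using congr($ha (v 0) (Fin.tail v))

end MultilinearForms

section AlternatingForms

variable {F V N : Type*} [Field F] [AddCommGroup V] [Module F V] [AddCommGroup N] [Module F N]
  {k : ℕ}

theorem alternatingMap_ne_zero_iff_span {ι : Type*} [Finite ι] (φ : V [⋀^ι]→ₗ[F] F) (v : ι → V) :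
    φ v ≠ 0 ↔ LinearIndependent F v ∧
      φ.compLinearMap (Submodule.span F (Set.range v)).subtype ≠ 0 := by
  by_cases hv : LinearIndependent F v
  · rw [and_iff_right hv, ← AlternatingMap.map_basis_ne_zero_iff (Module.Basis.span hv),
      AlternatingMap.compLinearMap_apply]
    simp only [Submodule.subtype_apply, Module.Basis.span_apply]
  · simp [hv, φ.map_linearDependent v hv]

theorem apply_eq_zero_of_mem_ker_curryLeft {φ : V [⋀^Fin (k + 1)]→ₗ[F] N} {x : V}
    (hx : x ∈ LinearMap.ker φ.curryLeft) {v : Fin (k + 1) → V} {i : Fin (k + 1)} (hi : v i = x) :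
    φ v = 0 := by
  have hswap : φ (v ∘ Equiv.swap 0 i) = 0 := by
    have h0 : (v ∘ Equiv.swap 0 i) 0 = x := by simp [hi]
    rw [← Fin.cons_self_tail (v ∘ Equiv.swap 0 i), h0]
    exact congr($hx _)
  rwa [φ.map_perm, smul_eq_zero_iff_eq] at hswap

theorem finrank_ker_curryLeft_add_le [Module.Finite F V] {φ : V [⋀^Fin (k + 1)]→ₗ[F] N}
    (hφ : φ ≠ 0) : Module.finrank F (LinearMap.ker φ.curryLeft) + (k + 1) ≤ Module.finrank F V := by
  obtain ⟨e, he⟩ : ∃ e, φ e ≠ 0 := by simpa [AlternatingMap.ext_iff] using hφ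
  have hli : LinearIndependent F e := not_imp_comm.1 (φ.map_linearDependent e) he
  have hdisj : Disjoint (LinearMap.ker φ.curryLeft) (Submodule.span F (Set.range e)) := by
    rw [Submodule.disjoint_def]
    intro x hx hxe
    obtain ⟨c, rfl⟩ := (Submodule.mem_span_range_iff_exists_fun F).1 hxe
    refine Finset.sum_eq_zero fun i _ => ?_
    have hexpand : φ (Function.update e i (∑ j, c j • e j)) = c i • φ e := by
      rw [φ.map_update_sum, Finset.sum_eq_single i]
      · simp
      · intro j _ hji
        simp [φ.map_update_self e hji.symm]
      · simp
    have hzero := apply_eq_zero_of_mem_ker_curryLeft hx (Function.update_self i _ e)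
    rw [hexpand, smul_eq_zero, or_iff_left he] at hzero
    rw [hzero, zero_smul]
  simpa [finrank_span_eq_card hli] using Submodule.finrank_add_finrank_le_of_disjoint hdisj

theorem le_ncard_compl_ker_curryLeft [Finite F] [Module.Finite F V]
    {φ : V [⋀^Fin (k + 1)]→ₗ[F] N} (hφ : φ ≠ 0) :
    Nat.card F ^ Module.finrank F V - Nat.card F ^ (Module.finrank F V - (k + 1)) ≤
      {x | φ.curryLeft x ≠ 0}.ncard := by
  have : Finite V := Module.finite_of_finite F
  have hcompl : {x | φ.curryLeft x ≠ 0} = (LinearMap.ker φ.curryLeft : Set V)ᶜ := rfl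
  rw [hcompl, Set.ncard_compl, ← Nat.card_coe_set_eq, SetLike.coe_sort_coe,
    Module.natCard_eq_pow_finrank (K := F) (V := V),
    Module.natCard_eq_pow_finrank (K := F) (V := LinearMap.ker φ.curryLeft)]
  gcongr
  · exact Nat.card_pos
  · exact Nat.le_sub_of_add_le (finrank_ker_curryLeft_add_le hφ)

/-- Choosing the vectors one at a time, the `i`-th one only has to avoid the radical of a nonzero
`i`-form, a subspace of codimension at least `i`. -/
theorem prod_le_ncard_ne_zero [Finite F] [Module.Finite F V] {φ : V [⋀^Fin k]→ₗ[F] N}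
    (hφ : φ ≠ 0) :
    ∏ i ∈ Finset.range k,
      (Nat.card F ^ Module.finrank F V - Nat.card F ^ (Module.finrank F V - (i + 1))) ≤
      {v | φ v ≠ 0}.ncard := by
  classical
  have : Finite V := Module.finite_of_finite F
  have := Fintype.ofFinite V
  induction k with
  | zero =>
    obtain ⟨v, hv⟩ : ∃ v, φ v ≠ 0 := by simpa [AlternatingMap.ext_iff] using hφ
    exact (Set.ncard_pos (Set.toFinite _)).2 ⟨v, hv⟩
  | succ k ih =>
    let split : {v // φ v ≠ 0} ≃ Σ x : V, {w // φ.curryLeft x w ≠ 0} :=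
      ((Fin.consEquiv fun _ => V).symm.subtypeEquiv fun v => by
        rw [AlternatingMap.curryLeft_apply_apply]
        exact (congrArg (φ · ≠ 0) (Fin.cons_self_tail v)).to_iff.symm).trans
        (Equiv.subtypeProdEquivSigmaSubtype fun x w => φ.curryLeft x w ≠ 0)
    rw [Finset.prod_range_succ, mul_comm]
    calc _ ≤ {x | φ.curryLeft x ≠ 0}.ncard * _ :=
          Nat.mul_le_mul_right _ (le_ncard_compl_ker_curryLeft hφ)
      _ = ∑ x with φ.curryLeft x ≠ 0, _ := by
          rw [Finset.sum_const, smul_eq_mul, ← Set.ncard_coe_finset, Finset.coe_filter_univ]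
      _ ≤ ∑ x with φ.curryLeft x ≠ 0, {w | φ.curryLeft x w ≠ 0}.ncard :=
          Finset.sum_le_sum fun x hx => ih (Finset.mem_filter.1 hx).2
      _ ≤ ∑ x, {w | φ.curryLeft x w ≠ 0}.ncard := Finset.sum_le_univ_sum_of_nonneg fun _ => zero_le
      _ = {v | φ v ≠ 0}.ncard := by
          rw [← Nat.card_coe_set_eq, Set.coe_ofPred, Nat.card_congr split, Nat.card_sigma]
          rfl

end AlternatingForms

section Counting

variable {F V : Type*} [Field F] [Finite F] [AddCommGroup V] [Module F V] [Module.Finite F V]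
  {k : ℕ}

theorem natCard_GL :
    Nat.card (GL (Fin k) F) = ∏ i : Fin k, (Nat.card F ^ k - Nat.card F ^ i.val) := by
  have := Fintype.ofFinite F
  rw [Matrix.card_GL_field, Nat.card_eq_fintype_card]

theorem natCard_linearIndependent_of_finrank_eq (hV : Module.finrank F V = k) :
    Nat.card {s : Fin k → V // LinearIndependent F s} = Nat.card (GL (Fin k) F) := by
  have : Finite V := Module.finite_of_finite F
  have := Fintype.ofFinite F
  rw [card_linearIndependent hV.ge, Matrix.card_GL_field, hV]

theorem cast_prod_pow_sub_pow {q n : ℕ} (hq : 0 < q) (hk : k ≤ n) :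
    ((∏ i : Fin k, (q ^ n - q ^ i.val) : ℕ) : ℚ) =
      ∏ i ∈ Finset.range k, ((q : ℚ) ^ n - (q : ℚ) ^ i) := by
  rw [Finset.prod_range, Nat.cast_prod]
  refine Finset.prod_congr rfl fun i _ => ?_
  rw [Nat.cast_sub (Nat.pow_le_pow_right hq (by lia)), Nat.cast_pow, Nat.cast_pow]

theorem pow_mul_natCard_GL {n : ℕ} (hk : k ≤ n) :
    Nat.card F ^ ((n - k) * k) * Nat.card (GL (Fin k) F) =
      ∏ i ∈ Finset.range k, (Nat.card F ^ n - Nat.card F ^ (n - (i + 1))) := by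
  rw [natCard_GL, ← Finset.prod_range (fun i => Nat.card F ^ k - Nat.card F ^ i), pow_mul,
    ← Finset.prod_range_reflect, Finset.pow_eq_prod_const, ← Finset.prod_mul_distrib]
  refine Finset.prod_congr rfl fun i hi => ?_
  have hi := Finset.mem_range.1 hi
  rw [Nat.mul_sub, ← pow_add, ← pow_add]
  congr <;> lia

theorem exists_ncard_ne_zero_eq (hk : k ≤ Module.finrank F V) :
    ∃ φ : V [⋀^Fin k]→ₗ[F] F, {v | φ v ≠ 0}.ncard =
      Nat.card F ^ ((Module.finrank F V - k) * k) * Nat.card (GL (Fin k) F) := by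
  let m := Module.finrank F V - k
  let E : V ≃ₗ[F] (Fin k → F) × (Fin m → F) := LinearEquiv.ofFinrankEq _ _ (by simp [m, hk])
  let φ : V [⋀^Fin k]→ₗ[F] F :=
    Matrix.detRowAlternating.compLinearMap (LinearMap.fst F _ _ ∘ₗ E.toLinearMap)
  have hφ (v : Fin k → V) : φ v ≠ 0 ↔ LinearIndependent F fun i => (E (v i)).1 := by
    rw [← isUnit_iff_ne_zero]
    exact (Matrix.isUnit_iff_isUnit_det _).symm.trans
      (Matrix.linearIndependent_rows_iff_isUnit (A := Matrix.of fun i => (E (v i)).1)).symm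
  let splitCoords : {v // φ v ≠ 0} ≃
      {s : Fin k → Fin k → F // LinearIndependent F s} × (Fin k → Fin m → F) :=
    { toFun := fun v => ⟨⟨fun i => (E (v.1 i)).1, (hφ v.1).1 v.2⟩, fun i => (E (v.1 i)).2⟩
      invFun := fun p => ⟨fun i => E.symm (p.1.1 i, p.2 i), (hφ _).2 (by simpa using p.1.2)⟩
      left_inv := fun v => by simp
      right_inv := fun p => by simp }
  refine ⟨φ, ?_⟩
  rw [← Nat.card_coe_set_eq, Set.coe_ofPred, Nat.card_congr splitCoords, Nat.card_prod,
    natCard_linearIndependent_of_finrank_eq (by simp), mul_comm]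
  simp [m, pow_mul, Nat.card_fun]

theorem isLeast_ncard_ne_zero (hk : k ≤ Module.finrank F V) :
    IsLeast {m | ∃ φ : V [⋀^Fin k]→ₗ[F] F, φ ≠ 0 ∧ {v | φ v ≠ 0}.ncard = m}
      (Nat.card F ^ ((Module.finrank F V - k) * k) * Nat.card (GL (Fin k) F)) := by
  constructor
  · obtain ⟨φ, hφ⟩ := exists_ncard_ne_zero_eq (F := F) (V := V) hk
    refine ⟨φ, ?_, hφ⟩
    rintro rfl
    have hpos : 0 < Nat.card F ^ ((Module.finrank F V - k) * k) * Nat.card (GL (Fin k) F) :=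
      mul_pos (pow_pos Nat.card_pos _) Nat.card_pos
    simp [← hφ] at hpos
  · rintro _ ⟨φ, hφ, rfl⟩
    rw [pow_mul_natCard_GL hk]
    exact prod_le_ncard_ne_zero hφ

theorem ncard_linearIndependent_span (p : Submodule F V → Prop) :
    {v : Fin k → V | LinearIndependent F v ∧ p (Submodule.span F (Set.range v))}.ncard =
      {X : GrassmannPoint F V k | p X.1}.ncard * Nat.card (GL (Fin k) F) := by
  classical
  have : Finite V := Module.finite_of_finite F
  have : Finite (Submodule F V) := Finite.of_injective _ SetLike.coe_injective
  have := Fintype.ofFinite {X : GrassmannPoint F V k // p X.1}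
  let f (B : Σ X : {X : GrassmannPoint F V k // p X.1},
      {s : Fin k → X.1.1 // LinearIndependent F s}) : Fin k → V := fun i => B.2.1 i
  have hspan (B) : Submodule.span F (Set.range (f B)) = B.1.1.1 := by
    change Submodule.span F (Set.range (B.1.1.1.subtype ∘ B.2.1)) = _
    rw [Set.range_comp, ← Submodule.map_span,
      B.2.2.span_eq_top_of_card_eq_finrank' (by simp [B.1.1.2]), Submodule.map_top,
      Submodule.range_subtype]
  have hinj : Function.Injective f := by
    rintro ⟨⟨⟨X, hX⟩, hpX⟩, s⟩ ⟨⟨⟨Y, hY⟩, hpY⟩, t⟩ hst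
    obtain rfl : X = Y :=
      (hspan _).symm.trans (congr(Submodule.span F (Set.range $hst)).trans (hspan _))
    congr
    exact Subtype.ext (funext fun i => Subtype.ext (congrFun hst i))
  have hrange : {v | LinearIndependent F v ∧ p (Submodule.span F (Set.range v))} = Set.range f := by
    ext v
    constructor
    · rintro ⟨hv, hpv⟩
      exact ⟨⟨⟨⟨_, (finrank_span_eq_card hv).trans (Fintype.card_fin k)⟩, hpv⟩,
        _, linearIndependent_span hv⟩, rfl⟩
    · rintro ⟨B, rfl⟩
      exact ⟨B.2.2.map' B.1.1.1.subtype B.1.1.1.ker_subtype, by rw [hspan]; exact B.1.2⟩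
  rw [hrange, ← Nat.card_coe_set_eq, Nat.card_range_of_injective hinj, Nat.card_sigma,
    Finset.sum_congr rfl fun X _ => natCard_linearIndependent_of_finrank_eq X.1.2,
    Finset.sum_const, smul_eq_mul, Finset.card_univ, ← Nat.card_eq_fintype_card,
    ← Nat.card_coe_set_eq, Set.coe_ofPred]

theorem natCard_grassmannPoint (hk : k ≤ Module.finrank F V) :
    (Nat.card (GrassmannPoint F V k) : ℚ) =
      (∏ i ∈ Finset.range k, ((Nat.card F : ℚ) ^ Module.finrank F V - (Nat.card F : ℚ) ^ i)) /
        ∏ i ∈ Finset.range k, ((Nat.card F : ℚ) ^ k - (Nat.card F : ℚ) ^ i) := by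
  have : Finite V := Module.finite_of_finite F
  have := Fintype.ofFinite F
  have hcount := ncard_linearIndependent_span (F := F) (V := V) (k := k) fun _ => True
  simp only [and_true, Set.ofPred_true, Set.ncard_univ] at hcount
  rw [← Nat.card_coe_set_eq, Set.coe_ofPred, card_linearIndependent hk,
    ← Nat.card_eq_fintype_card] at hcount
  have hGL : (Nat.card (GL (Fin k) F) : ℚ) ≠ 0 := Nat.cast_ne_zero.2 Nat.card_pos.ne'
  rw [← cast_prod_pow_sub_pow Nat.card_pos hk, ← cast_prod_pow_sub_pow Nat.card_pos le_rfl,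
    ← natCard_GL, eq_div_iff hGL, hcount, Nat.cast_mul]

end Counting

section Grassmann

variable {F V : Type*} [Field F] [AddCommGroup V] [Module F V] {k : ℕ}

theorem exists_projection_apply_eq_zero {X : Submodule F V} {y : V} (hy : y ∉ X) :
    ∃ p : V →ₗ[F] X, p ∘ₗ X.subtype = LinearMap.id ∧ p y = 0 := by
  have hker : LinearMap.ker ((F ∙ y).mkQ ∘ₗ X.subtype) = ⊥ := by
    rw [LinearMap.ker_comp, Submodule.ker_mkQ, ← Submodule.disjoint_iff_comap_eq_bot]
    exact Submodule.disjoint_span_singleton_of_notMem hy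
  obtain ⟨g, hg⟩ := LinearMap.exists_leftInverse_of_injective _ hker
  refine ⟨g ∘ₗ (F ∙ y).mkQ, hg, ?_⟩
  have hmk : (F ∙ y).mkQ y = 0 :=
    (Submodule.Quotient.mk_eq_zero _).2 (Submodule.mem_span_singleton_self y)
  rw [LinearMap.comp_apply, hmk, map_zero]

variable [Module.Finite F V]

theorem submodule_grassmannEmbedding_le_ker_iff {X : GrassmannPoint F V k}
    {φ : V [⋀^Fin k]→ₗ[F] F} :
    (grassmannEmbedding k X).submodule ≤
        LinearMap.ker (exteriorPower.alternatingMapLinearEquiv φ) ↔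
      φ.compLinearMap X.1.subtype = 0 := by
  rw [grassmannEmbedding, Projectivization.submodule_mk, Submodule.span_singleton_le_iff_mem,
    LinearMap.mem_ker, exteriorPower.alternatingMapLinearEquiv_apply_ιMulti]
  exact AlternatingMap.map_basis_eq_zero_iff (Module.finBasisOfFinrankEq F X.1 X.2)
    (φ.compLinearMap X.1.subtype)

/-- The form is the determinant of a projection `V → X` along some `y ∈ Y \ X`. -/
theorem exists_compLinearMap_subtype_ne_zero_and_eq_zero {X Y : GrassmannPoint F V k}
    (hYX : ¬ Y.1 ≤ X.1) :
    ∃ φ : V [⋀^Fin k]→ₗ[F] F, φ.compLinearMap X.1.subtype ≠ 0 ∧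
      φ.compLinearMap Y.1.subtype = 0 := by
  obtain ⟨y, hyY, hyX⟩ := SetLike.not_le_iff_exists.1 hYX
  obtain ⟨p, hpX, hpy⟩ := exists_projection_apply_eq_zero hyX
  let b := Module.finBasisOfFinrankEq F X.1 X.2
  refine ⟨b.det.compLinearMap p, ?_, ?_⟩
  · rw [AlternatingMap.compLinearMap_assoc, hpX, AlternatingMap.compLinearMap_id]
    exact b.det_ne_zero
  · ext w
    by_contra hw
    have hspan : Submodule.span F (Set.range (p ∘ Y.1.subtype ∘ w)) = ⊤ :=
      (b.is_basis_iff_det.2 (isUnit_iff_ne_zero.2 hw)).2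
    have hsurj : Function.Surjective (p ∘ₗ Y.1.subtype) := by
      rw [← LinearMap.range_eq_top, eq_top_iff, ← hspan, Submodule.span_le]
      rintro _ ⟨i, rfl⟩
      exact ⟨w i, rfl⟩
    have hinj : Function.Injective (p ∘ₗ Y.1.subtype) :=
      (LinearMap.injective_iff_surjective_of_finrank_eq_finrank (Y.2.trans X.2.symm)).2 hsurj
    have hy0 : (⟨y, hyY⟩ : Y.1) = 0 := hinj (by simpa using hpy)
    have hy : y = 0 := congrArg Subtype.val hy0
    exact hyX (hy ▸ X.1.zero_mem)

theorem grassmannEmbedding_injective :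
    Function.Injective (grassmannEmbedding (F := F) (V := V) k) := by
  intro X Y hXY
  suffices hYX : Y.1 ≤ X.1 from
    Subtype.ext (Submodule.eq_of_le_of_finrank_eq hYX (Y.2.trans X.2.symm)).symm
  by_contra hYX
  obtain ⟨φ, hφX, hφY⟩ := exists_compLinearMap_subtype_ne_zero_and_eq_zero hYX
  rw [← submodule_grassmannEmbedding_le_ker_iff, ← hXY,
    submodule_grassmannEmbedding_le_ker_iff] at hφY
  exact hφX hφY

theorem isCutting_range_grassmannEmbedding :
    IsCutting (Set.range (grassmannEmbedding (F := F) (V := V) k)) := by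
  intro f g hfg
  obtain ⟨φ, rfl⟩ := exteriorPower.alternatingMapLinearEquiv.surjective f
  obtain ⟨ψ, rfl⟩ := exteriorPower.alternatingMapLinearEquiv.surjective g
  have hzero (v : Fin k → V) : φ v = 0 → ψ v = 0 := by
    contrapose!
    rw [alternatingMap_ne_zero_iff_span, alternatingMap_ne_zero_iff_span]
    rintro ⟨hv, hψ⟩
    let X : GrassmannPoint F V k := ⟨_, (finrank_span_eq_card hv).trans (Fintype.card_fin k)⟩
    refine ⟨hv, mt (fun hφ => ?_) hψ⟩
    exact submodule_grassmannEmbedding_le_ker_iff.1 <|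
      hfg (grassmannEmbedding k X) ⟨X, rfl⟩ (submodule_grassmannEmbedding_le_ker_iff.2 hφ)
  obtain ⟨a, ha⟩ := exists_eq_smul_of_eq_zero_imp (φ := φ.toMultilinearMap) hzero
  have hψ : ψ = a • φ := AlternatingMap.coe_multilinearMap_injective ha
  exact ⟨a, by rw [hψ, map_smul]⟩

theorem ncard_grassmannEmbedding_mul_natCard_GL [Finite F] (φ : V [⋀^Fin k]→ₗ[F] F) :
    {P ∈ Set.range (grassmannEmbedding (F := F) (V := V) k) |
        ¬ P.submodule ≤ LinearMap.ker (exteriorPower.alternatingMapLinearEquiv φ)}.ncard *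
      Nat.card (GL (Fin k) F) = {v | φ v ≠ 0}.ncard := by
  simp only [alternatingMap_ne_zero_iff_span]
  rw [ncard_linearIndependent_span fun X => φ.compLinearMap X.subtype ≠ 0,
    ← Set.ncard_image_of_injective _ grassmannEmbedding_injective]
  congr 2
  ext P
  constructor
  · rintro ⟨⟨X, rfl⟩, hX⟩
    exact ⟨X, mt submodule_grassmannEmbedding_le_ker_iff.2 hX, rfl⟩
  · rintro ⟨X, hX, rfl⟩
    exact ⟨⟨X, rfl⟩, mt submodule_grassmannEmbedding_le_ker_iff.1 hX⟩

theorem isLeast_ncard_grassmannEmbedding [Finite F] (hk : k ≤ Module.finrank F V) :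
    IsLeast {m | ∃ f : Module.Dual F (⋀[F]^k V), f ≠ 0 ∧
      {P ∈ Set.range (grassmannEmbedding (F := F) (V := V) k) |
        ¬ P.submodule ≤ LinearMap.ker f}.ncard = m}
      (Nat.card F ^ ((Module.finrank F V - k) * k)) := by
  have hGL : 0 < Nat.card (GL (Fin k) F) := Nat.card_pos
  obtain ⟨⟨φ, hφ, hcard⟩, hmin⟩ := isLeast_ncard_ne_zero (F := F) (V := V) hk
  constructor
  · rw [← ncard_grassmannEmbedding_mul_natCard_GL] at hcard
    exact ⟨_, (LinearEquiv.map_ne_zero_iff _).2 hφ, Nat.eq_of_mul_eq_mul_right hGL hcard⟩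
  · rintro _ ⟨f, hf, rfl⟩
    obtain ⟨ψ, rfl⟩ := exteriorPower.alternatingMapLinearEquiv.surjective f
    refine Nat.le_of_mul_le_mul_right ?_ hGL
    rw [ncard_grassmannEmbedding_mul_natCard_GL]
    exact hmin ⟨ψ, (LinearEquiv.map_ne_zero_iff _).1 hf, rfl⟩

end Grassmann

end MinimalCodes

theorem theorem4p1 {F V : Type*} [Field F] [Fintype F] [DecidableEq F] [AddCommGroup V] [Module F V]
    [Module.Finite F V] (q n k : ℕ) (hq : Fintype.card F = q) (hn : Module.finrank F V = n)
    (hk : 1 ≤ k) (hkn : k < n) {N : ℕ} (C : Submodule F (Fin N → F))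
    (hC : MinimalCodes.IsGrassmannCode V k C) :
    MinimalCodes.IsMinimalCode C ∧
      (N : ℚ) = (∏ i ∈ Finset.range k, ((q : ℚ) ^ n - (q : ℚ) ^ i)) /
        ∏ i ∈ Finset.range k, ((q : ℚ) ^ k - (q : ℚ) ^ i) ∧
      Module.finrank F C = n.choose k ∧
      MinimalCodes.IsMinimumDistance C (q ^ ((n - k) * k)) := by
  subst hn hq
  have hcut := MinimalCodes.isCutting_range_grassmannEmbedding (F := F) (V := V) (k := k)
  rw [← Nat.card_eq_fintype_card]
  refine ⟨hC.isMinimalCode hcut, ?_, ?_, ?_⟩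
  · rw [hC.length_eq_ncard, ← MinimalCodes.natCard_grassmannPoint hkn.le, ← Nat.card_coe_set_eq,
      Nat.card_range_of_injective MinimalCodes.grassmannEmbedding_injective]
  · rw [hC.finrank_eq fun _ => hcut.eq_zero, exteriorPower.finrank_eq]
  · exact hC.isMinimumDistance (fun _ => hcut.eq_zero)
      (MinimalCodes.isLeast_ncard_grassmannEmbedding hkn.le)
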